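/- A persuasion instance consists of a finite set $\Theta$ of states with a prior $\mu\in\Delta(\Theta)$, a finite set $T$ of $n=|T|$ agent types with a distribution $\rho\in\Delta(T)$ (the type is independent of the state), a set $A$ of actions, a payoff function $u_t:\Theta\times A\to\mathbb R$ for each agent type $t\in T$, and a payoff function $v:\Theta\times A\to\mathbb R$ of the principal. A mechanism with partial information elicitation (a PIE mechanism) is a finite rooted tree whose non-terminal nodes are of three kinds: at a signaling node the principal sends one of finitely many signals, drawn from a distribution that may depend on the state, and the play moves to the corresponding child; at a non-binding elicitation node the agent selects one of finitely many children; at a binding elicitation node the principal presents finitely many sets $B_1,\dots,B_m$ of types, which together cover the set of types not yet excluded, and the agent selects one of them. Write $T_x\subseteq T$ for the set of types not excluded by the binding answers on the path to a node $x$; thus $T_x=T$ at the root, the answer $B_k$ at $x$ leads to a child $c$ with $T_c=T_x\cap B_k$, and it may be selected only if $T_x\cap B_k\neq\emptyset$. At a leaf $x$ the agent chooses a type $t'\in T_x$ to act as, and an action that is optimal for type $t'$ under the posterior belief at $x$ is played. The agent of true type $t$ knows the mechanism and follows a plan (a choice at every elicitation node and every leaf) that maximizes the expectation of $u_t$. All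 ties are broken by the mechanism: it specifies, for each leaf and each $t'$, which of the actions optimal for $t'$ is played, and, for each true type, which of the agent's optimal plans is followed. The depth of a mechanism is the maximal number of non-terminal nodes on a path from the root, and the principal's payoff is the expectation of $v$ when the type is drawn from $\rho$ and the state from $\mu$. Theorem. There is an absolute constant $C$ such that for every persuasion instance with $n$ types and every PIE mechanism $\Pi$ for it, there is a PIE mechanism $\Pi'$ for the same instance, of depth at most $Cn$, that gives the principal at least as much payoff as $\Pi$. Moreover, $\Pi'$ can be taken such that at each of its binding elicitation nodes the sets $B_1,\dots,B_m$ are pairwise disjoint. -/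

import Mathlib

/-- A Bayesian persuasion instance with a privately informed agent: `μ` is the common prior over
the finite set `Θ` of states, `ρ` is the distribution of the agent's type (independent of the
state), `u t` is the payoff function of an agent of type `t`, and `v` is the principal's. -/
structure PersuasionInstance (Θ A T : Type*) [Fintype Θ] [Fintype T] where
  μ : Θ → ℝ
  μ_mem : μ ∈ stdSimplex ℝ Θ
  ρ : T → ℝ
  ρ_mem : ρ ∈ stdSimplex ℝ T
  u : T → Θ → A → ℝ
  v : Θ → A → ℝ

/-- The game tree of a multi-stage mechanism. -/
inductive MechTree (Θ A T : Type*) where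
  /-- The mechanism terminates. `act t` is the action played by an agent who behaves as type `t`;
  it has to be optimal for type `t` (see `MechTree.Valid`), so that `act` only decides ties. -/
  | leaf (act : T → A) : MechTree Θ A T
  /-- A signaling node: in state `θ`, signal `k` is sent with probability `π θ k`. -/
  | signal (m : ℕ) (π : Θ → Fin m → ℝ) (child : Fin m → MechTree Θ A T) : MechTree Θ A T
  /-- A non-binding elicitation node: the agent selects one of the children. -/
  | menu (m : ℕ) (child : Fin m → MechTree Θ A T) : MechTree Θ A T
  /-- A binding (partial) elicitation node: the agent is asked which of the sets `B k` of types
  contains his type. -/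
  | elicit (m : ℕ) (B : Fin m → Set T) (child : Fin m → MechTree Θ A T) : MechTree Θ A T

namespace MechTree

variable {Θ A T : Type*}

/-- The depth of the tree: the maximal number of non-terminal nodes on a path from the root. -/
def depth : MechTree Θ A T → ℕ
  | leaf _ => 0
  | signal _ _ c => 1 + Finset.univ.sup fun k => (c k).depth
  | menu _ c => 1 + Finset.univ.sup fun k => (c k).depth
  | elicit _ _ c => 1 + Finset.univ.sup fun k => (c k).depth

/-- At every binding elicitation node the possible answers are pairwise disjoint. -/
def DisjointAnswers : MechTree Θ A T → Prop
  | leaf _ => True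
  | signal _ _ c => ∀ k, (c k).DisjointAnswers
  | menu _ c => ∀ k, (c k).DisjointAnswers
  | elicit _ B c => (∀ j k, j ≠ k → Disjoint (B j) (B k)) ∧ ∀ k, (c k).DisjointAnswers

/-- Well-formedness of a tree when the types not yet excluded by the agent's binding answers are
those in `R` and the belief about the state is proportional to `w`; here `w θ` is the joint
probability of the state `θ` and of the signals sent so far. -/
def Valid [Fintype Θ] (u : T → Θ → A → ℝ) : MechTree Θ A T → Set T → (Θ → ℝ) → Prop
  | leaf act, R, w =>
      ∀ t ∈ R, ∀ a, ∑ θ, w θ * u t θ a ≤ ∑ θ, w θ * u t θ (act t)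
  | signal m π c, R, w =>
      (∀ θ, π θ ∈ stdSimplex ℝ (Fin m)) ∧ ∀ k, (c k).Valid u R fun θ => w θ * π θ k
  | menu m c, R, w => 0 < m ∧ ∀ k, (c k).Valid u R w
  | elicit m B c, R, w =>
      0 < m ∧ (∀ t ∈ R, ∃ k, t ∈ B k) ∧ ∀ k, (c k).Valid u (R ∩ B k) w

/-- A plan of the agent: a child to select at each elicitation node (binding or not), and a type
to act as at each leaf. -/
def Plan : MechTree Θ A T → Type _
  | leaf _ => T
  | signal m _ c => ∀ k : Fin m, (c k).Plan
  | menu m c => Fin m × ∀ k : Fin m, (c k).Plan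
  | elicit m _ c => Fin m × ∀ k : Fin m, (c k).Plan

/-- Credibility of a plan: every binding answer, and every type acted as at a leaf, is consistent
with the earlier binding answers. `R` is the set of types not yet excluded. -/
def Credible : (N : MechTree Θ A T) → Set T → N.Plan → Prop
  | leaf _, R, s => s ∈ R
  | signal _ _ c, R, s => ∀ k, (c k).Credible R (s k)
  | menu _ c, R, s => ∀ k, (c k).Credible R (s.2 k)
  | elicit _ B c, R, s =>
      (R ∩ B s.1).Nonempty ∧ ∀ k, (R ∩ B k).Nonempty → (c k).Credible (R ∩ B k) (s.2 k)

/-- The expectation of `f θ a`, for the final action `a`, when the agent follows the plan `s`; `w`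
is as in `Valid`. -/
def payoff [Fintype Θ] (f : Θ → A → ℝ) : (N : MechTree Θ A T) → N.Plan → (Θ → ℝ) → ℝ
  | leaf act, s, w => ∑ θ, w θ * f θ (act s)
  | signal _ π c, s, w => ∑ k, (c k).payoff f (s k) fun θ => w θ * π θ k
  | menu _ c, s, w => (c s.1).payoff f (s.2 s.1) w
  | elicit _ _ c, s, w => (c s.1).payoff f (s.2 s.1) w

end MechTree

/-- A mechanism with partial information elicitation: a well-formed tree together with, for each
type, an optimal credible plan. The choice among the optimal plans is the tie-breaking rule of the
mechanism. -/
structure PIEMechanism {Θ A T : Type*} [Fintype Θ] [Fintype T] (I : PersuasionInstance Θ A T) where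
  tree : MechTree Θ A T
  valid : tree.Valid I.u Set.univ I.μ
  plan : T → tree.Plan
  credible : ∀ t, tree.Credible Set.univ (plan t)
  optimal : ∀ t, ∀ s, tree.Credible Set.univ s →
    tree.payoff (I.u t) s I.μ ≤ tree.payoff (I.u t) (plan t) I.μ

/-- The principal's expected payoff under a mechanism. -/
def PIEMechanism.principalPayoff {Θ A T : Type*} [Fintype Θ] [Fintype T]
    {I : PersuasionInstance Θ A T} (P : PIEMechanism I) : ℝ :=
  ∑ t, I.ρ t * P.tree.payoff I.v (P.plan t) I.μ

namespace MechTree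

variable {Θ A T : Type*}

/-! The plan `s` that a type follows in the given mechanism can be isolated in a shallow tree: a
menu is replaced by the choice of `s`, successive signals are merged, and a binding node is dropped
if the answer of `s` excludes nobody. Otherwise it offers that answer `B` and, to keep every type
covered, a singleton for each type of `R \ B`. Below a singleton one signal suffices, and along `B`
the set `R` shrinks strictly, so at most `n - 1` binding nodes alternate with signals
(`exists_prunes`).

The pruned tree keeps the outcome of `s` and adds no outcome that was unavailable before (`Prunes`).
The new mechanism is a root menu of the pruned trees, one for each type's plan. A type's old outcome
is still on offer and still optimal, and ties can be broken in its favour, so the principal's payoff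
is unchanged. -/

theorem Valid.mono [Fintype Θ] {u : T → Θ → A → ℝ} {N : MechTree Θ A T} {R S : Set T}
    {w : Θ → ℝ} (h : N.Valid u R w) (hS : S ⊆ R) : N.Valid u S w := by
  induction N generalizing R S w with
  | leaf act => exact fun t ht => h t (hS ht)
  | signal m π c ih => exact ⟨h.1, fun k => ih k (h.2 k) hS⟩
  | menu m c ih => exact ⟨h.1, fun k => ih k (h.2 k) hS⟩
  | elicit m B c ih =>
    exact ⟨h.1, fun t ht => h.2.1 t (hS ht),
      fun k => ih k (h.2.2 k) (Set.inter_subset_inter_left _ hS)⟩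

theorem Valid.nonempty_plan [Fintype Θ] {u : T → Θ → A → ℝ} {N : MechTree Θ A T} {R : Set T}
    {w : Θ → ℝ} (h : N.Valid u R w) [Nonempty T] : Nonempty N.Plan := by
  induction N generalizing R w with
  | leaf act => exact ‹Nonempty T›
  | signal m π c ih => exact ⟨fun k => (ih k (h.2 k)).some⟩
  | menu m c ih => exact ⟨(⟨0, h.1⟩, fun k => (ih k (h.2 k)).some)⟩
  | elicit m B c ih => exact ⟨(⟨0, h.1⟩, fun k => (ih k (h.2.2 k)).some)⟩

theorem Valid.exists_credible [Fintype Θ] {u : T → Θ → A → ℝ} {N : MechTree Θ A T} {R : Set T}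
    {w : Θ → ℝ} (h : N.Valid u R w) (hR : R.Nonempty) : ∃ s, N.Credible R s := by
  classical
  induction N generalizing R w with
  | leaf act => exact hR
  | signal m π c ih =>
    choose s hs using fun k => ih k (h.2 k) hR
    exact ⟨s, hs⟩
  | menu m c ih =>
    choose s hs using fun k => ih k (h.2 k) hR
    exact ⟨(⟨0, h.1⟩, s), hs⟩
  | elicit m B c ih =>
    obtain ⟨t, ht⟩ := hR
    have : Nonempty T := ⟨t⟩
    obtain ⟨j, hj⟩ := h.2.1 t ht
    -- Plans are total, so a branch that no type in `R` may enter also needs an arbitrary plan.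
    have key : ∀ k, ∃ s : (c k).Plan, (R ∩ B k).Nonempty → (c k).Credible (R ∩ B k) s := by
      intro k
      by_cases hk : (R ∩ B k).Nonempty
      · obtain ⟨s, hs⟩ := ih k (h.2.2 k) hk
        exact ⟨s, fun _ => hs⟩
      · exact ⟨(h.2.2 k).nonempty_plan.some, fun h' => absurd h' hk⟩
    choose s hs using key
    exact ⟨(j, s), ⟨t, ht, hj⟩, hs⟩

/-- A credible plan remains available, up to unreached choices, when fewer types are excluded. -/
theorem Valid.exists_credible_of_subset [Fintype Θ] {u : T → Θ → A → ℝ} {N : MechTree Θ A T}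
    {R S : Set T} {w : Θ → ℝ} (h : N.Valid u R w) (hS : S ⊆ R) {s : N.Plan}
    (hs : N.Credible S s) :
    ∃ s', N.Credible R s' ∧ ∀ f w', N.payoff f s' w' = N.payoff f s w' := by
  classical
  induction N generalizing R S w with
  | leaf act => exact ⟨s, hS hs, fun _ _ => rfl⟩
  | signal m π c ih =>
    choose s' hs' hp using fun k => ih k (h.2 k) hS (hs k)
    exact ⟨s', hs', fun f w' => Finset.sum_congr rfl fun k _ => hp k f _⟩
  | menu m c ih =>
    choose s' hs' hp using fun k => ih k (h.2 k) hS (hs k)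
    exact ⟨(s.1, s'), hs', fun f w' => hp s.1 f w'⟩
  | elicit m B c ih =>
    have hsub := fun k => Set.inter_subset_inter_left (B k) hS
    -- Branches empty for `S` may be nonempty for `R`, and there `s` need not be credible. Off the
    -- selected branch `s` is therefore replaced by a plan `r` credible for `R`.
    obtain ⟨r, hr⟩ := h.exists_credible ((hs.1.mono (hsub _)).mono Set.inter_subset_left)
    obtain ⟨s', hs', hp⟩ := ih s.1 (h.2.2 s.1) (hsub _) (hs.2 s.1 hs.1)
    refine ⟨(s.1, Function.update r.2 s.1 s'), ⟨hs.1.mono (hsub _), fun k hk => ?_⟩,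
      fun f w' => ?_⟩
    · by_cases hks : k = s.1
      · subst hks
        simpa using hs'
      · simpa [Function.update_of_ne hks] using hr.2 k hk
    · simpa [payoff] using hp f w'

/-- Every credible plan of `N'` has the same outcome as some credible plan of `N`. -/
def Simulates [Fintype Θ] (N : MechTree Θ A T) (R : Set T) (N' : MechTree Θ A T) (R' : Set T)
    (w : Θ → ℝ) : Prop :=
  ∀ s', N'.Credible R' s' →
    ∃ s, N.Credible R s ∧ ∀ f : Θ → A → ℝ, N.payoff f s w = N'.payoff f s' w

theorem Simulates.menu [Fintype Θ] {m : ℕ} {c : Fin m → MechTree Θ A T} {R R' : Set T}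
    {w : Θ → ℝ} {N' : MechTree Θ A T} {s : (menu m c).Plan} (hs : (menu m c).Credible R s)
    {k : Fin m} (h : (c k).Simulates R N' R' w) : (menu m c).Simulates R N' R' w := by
  classical
  intro s' hs'
  obtain ⟨r, hr, hp⟩ := h s' hs'
  refine ⟨(k, Function.update s.2 k r), fun j => ?_, fun f => ?_⟩
  · by_cases hj : j = k
    · subst hj
      simpa using hr
    · simpa [Function.update_of_ne hj] using hs j
  · simpa [payoff] using hp f

theorem Simulates.elicit [Fintype Θ] {m : ℕ} {B : Fin m → Set T} {c : Fin m → MechTree Θ A T}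
    {R R' : Set T} {w : Θ → ℝ} {N' : MechTree Θ A T} {s : (elicit m B c).Plan}
    (hs : (elicit m B c).Credible R s) {k : Fin m} (hk : (R ∩ B k).Nonempty)
    (h : (c k).Simulates (R ∩ B k) N' R' w) : (elicit m B c).Simulates R N' R' w := by
  classical
  intro s' hs'
  obtain ⟨r, hr, hp⟩ := h s' hs'
  refine ⟨(k, Function.update s.2 k r), ⟨hk, fun j hj' => ?_⟩, fun f => ?_⟩
  · by_cases hj : j = k
    · subst hj
      simpa using hr
    · simpa [Function.update_of_ne hj] using hs.2 j hj'
  · simpa [payoff] using hp f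

/-- Needed for singleton answers: the pruned branch knows the type exactly, while the original
answer excludes fewer types. -/
theorem Simulates.of_subset [Fintype Θ] {u : T → Θ → A → ℝ} {N N' : MechTree Θ A T}
    {R S R' : Set T} {w : Θ → ℝ} (hN : N.Valid u R w) (hS : S ⊆ R)
    (h : N.Simulates S N' R' w) : N.Simulates R N' R' w := by
  intro s' hs'
  obtain ⟨r, hr, hp⟩ := h s' hs'
  obtain ⟨r', hr', hp'⟩ := hN.exists_credible_of_subset hS hr
  exact ⟨r', hr', fun f => (hp' f w).trans (hp f)⟩

/-- `N'` offers the outcome of the plan `s` of `N`, and only outcomes available in `N`. -/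
structure Prunes [Fintype Θ] (u : T → Θ → A → ℝ) (N : MechTree Θ A T) (R : Set T) (w : Θ → ℝ)
    (s : N.Plan) (N' : MechTree Θ A T) : Prop where
  valid : N'.Valid u R w
  disjoint : N'.DisjointAnswers
  simulates : N.Simulates R N' R w
  exists_plan : ∃ s', N'.Credible R s' ∧ ∀ f : Θ → A → ℝ, N'.payoff f s' w = N.payoff f s w

/-- Prefixing a tree by an uninformative signal. -/
theorem Prunes.trivial_signal [Fintype Θ] {u : T → Θ → A → ℝ} {N N' : MechTree Θ A T}
    {R : Set T} {w : Θ → ℝ} {s : N.Plan} (h : N.Prunes u R w s N') :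
    N.Prunes u R w s (signal 1 (fun _ _ => 1) fun _ => N') where
  valid := ⟨fun θ => ⟨fun _ => zero_le_one, by simp⟩, fun k => by simpa using h.valid⟩
  disjoint := fun _ => h.disjoint
  simulates := by
    intro s' hs'
    obtain ⟨r, hr, hp⟩ := h.simulates (s' 0) (hs' 0)
    exact ⟨r, hr, fun f => by simpa [payoff] using hp f⟩
  exists_plan := by
    obtain ⟨r, hr, hp⟩ := h.exists_plan
    exact ⟨fun _ => r, fun _ => hr, fun f => by simpa [payoff] using hp f⟩

/-- Successive signals can be merged into one. -/
theorem Prunes.signal [Fintype Θ] {u : T → Θ → A → ℝ} {R : Set T} {w : Θ → ℝ} {m : ℕ}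
    {π : Θ → Fin m → ℝ} (hπ : ∀ θ, π θ ∈ stdSimplex ℝ (Fin m)) {c : Fin m → MechTree Θ A T}
    {s : (signal m π c).Plan} {m' : Fin m → ℕ} {π' : ∀ k, Θ → Fin (m' k) → ℝ}
    {c' : ∀ k, Fin (m' k) → MechTree Θ A T}
    (h : ∀ k, (c k).Prunes u R (fun θ => w θ * π θ k) (s k)
      (MechTree.signal (m' k) (π' k) (c' k)))
    {p : ℕ} (e : Fin p ≃ Σ k, Fin (m' k)) :
    (MechTree.signal m π c).Prunes u R w s
      (MechTree.signal p (fun θ i => π θ (e i).1 * π' (e i).1 θ (e i).2)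
        fun i => c' (e i).1 (e i).2) where
  valid := by
    refine ⟨fun θ => ⟨fun i => mul_nonneg ((hπ θ).1 _) (((h _).valid.1 θ).1 _), ?_⟩, fun i => ?_⟩
    · rw [e.sum_comp fun x : Σ k, Fin (m' k) => π θ x.1 * π' x.1 θ x.2, Fintype.sum_sigma]
      simp_rw [← Finset.mul_sum, ((h _).valid.1 θ).2, mul_one]
      exact (hπ θ).2
    · simpa only [mul_assoc] using (h (e i).1).valid.2 (e i).2
  disjoint := fun i => (h (e i).1).disjoint (e i).2
  simulates := by
    intro s' hs'
    -- The type of a plan depends on its branch, so reindexing along `e` requires a cast.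
    let r : ∀ x : Σ k, Fin (m' k), (c' x.1 x.2).Plan := fun x =>
      cast (congrArg (fun y => (c' y.1 y.2).Plan) (e.apply_symm_apply x)) (s' (e.symm x))
    have hr : ∀ i, r (e i) = s' i := by
      intro i
      apply eq_of_heq
      refine (cast_heq _ _).trans ?_
      rw [e.symm_apply_apply]
    have hrc : ∀ x, (c' x.1 x.2).Credible R (r x) := by
      intro x
      obtain ⟨i, rfl⟩ := e.surjective x
      rw [hr]
      exact hs' i
    choose q hq hp using fun k => (h k).simulates (fun j => r ⟨k, j⟩) fun j => hrc ⟨k, j⟩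
    refine ⟨q, hq, fun f => ?_⟩
    calc _ = ∑ k, ∑ j, (c' k j).payoff f (r ⟨k, j⟩) fun θ => w θ * π θ k * π' k θ j :=
          Finset.sum_congr rfl fun k _ => hp k f
      _ = ∑ x : Σ k, Fin (m' k),
            (c' x.1 x.2).payoff f (r x) fun θ => w θ * π θ x.1 * π' x.1 θ x.2 :=
          (Fintype.sum_sigma fun x : Σ k, Fin (m' k) => (c' x.1 x.2).payoff f (r x)
            fun θ => w θ * π θ x.1 * π' x.1 θ x.2).symm
      _ = _ := by
          rw [← e.sum_comp]
          simp only [payoff, hr, mul_assoc]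
  exists_plan := by
    choose q hq hp using fun k => (h k).exists_plan
    refine ⟨fun i => q (e i).1 (e i).2, fun i => hq (e i).1 (e i).2, fun f => ?_⟩
    symm
    calc _ = ∑ k, ∑ j, (c' k j).payoff f (q k j) fun θ => w θ * π θ k * π' k θ j :=
          Finset.sum_congr rfl fun k _ => (hp k f).symm
      _ = ∑ x : Σ k, Fin (m' k),
            (c' x.1 x.2).payoff f (q x.1 x.2) fun θ => w θ * π θ x.1 * π' x.1 θ x.2 :=
          (Fintype.sum_sigma fun x : Σ k, Fin (m' k) => (c' x.1 x.2).payoff f (q x.1 x.2)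
            fun θ => w θ * π θ x.1 * π' x.1 θ x.2).symm
      _ = _ := by
          rw [← e.sum_comp]
          simp only [payoff, mul_assoc]

/-- The answers offered at a pruned elicitation node: a given set, and singletons for the types
outside of it. -/
def prunedAnswers (R S : Set T) : Option {t // t ∈ R \ S} → Set T
  | none => S
  | some t => {t.1}

/-- A singleton answer `{t}` is harmless: its branch is pruned from some `c k` with `t ∈ B k`, so
whoever gives it could have answered `B k` and then acted as `t`. -/
theorem Prunes.elicit [Fintype Θ] {u : T → Θ → A → ℝ} {R : Set T} {w : Θ → ℝ} {m : ℕ}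
    {B : Fin m → Set T} {c : Fin m → MechTree Θ A T} {s : (elicit m B c).Plan}
    (hv : (elicit m B c).Valid u R w) (hs : (elicit m B c).Credible R s)
    {c' : Option {t // t ∈ R \ B s.1} → MechTree Θ A T}
    (h : (c s.1).Prunes u (R ∩ B s.1) w (s.2 s.1) (c' none))
    (h' : ∀ t : {t // t ∈ R \ B s.1}, ∃ k, t.1 ∈ B k ∧
      ∃ r, (c k).Prunes u {t.1} w r (c' (some t)))
    {p : ℕ} (e : Fin p ≃ Option {t // t ∈ R \ B s.1}) :
    (MechTree.elicit m B c).Prunes u R w s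
      (MechTree.elicit p (fun i => prunedAnswers R (B s.1) (e i)) fun i => c' (e i)) := by
  have hsing : ∀ t : {t // t ∈ R \ B s.1}, R ∩ {t.1} = {t.1} := fun t =>
    Set.inter_eq_right.2 (Set.singleton_subset_iff.2 t.2.1)
  have hval : ∀ x, (c' x).Valid u (R ∩ prunedAnswers R (B s.1) x) w := by
    rintro (_ | t)
    · exact h.valid
    · obtain ⟨k, -, r, hr⟩ := h' t
      exact hsing t ▸ hr.valid
  have hdis : ∀ x, (c' x).DisjointAnswers := by
    rintro (_ | t)
    · exact h.disjoint
    · obtain ⟨k, -, r, hr⟩ := h' t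
      exact hr.disjoint
  have hsim : ∀ x, (MechTree.elicit m B c).Simulates R (c' x)
      (R ∩ prunedAnswers R (B s.1) x) w := by
    rintro (_ | t)
    · exact h.simulates.elicit hs hs.1
    · obtain ⟨k, hk, r, hr⟩ := h' t
      have hsub : {t.1} ⊆ R ∩ B k := Set.singleton_subset_iff.2 ⟨t.2.1, hk⟩
      have := (hr.simulates.of_subset (hv.2.2 k) hsub).elicit hs ⟨t.1, t.2.1, hk⟩
      exact (hsing t).symm ▸ this
  have hne : ∀ x, (R ∩ prunedAnswers R (B s.1) x).Nonempty := by
    rintro (_ | t)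
    · exact hs.1
    · exact ⟨t.1, t.2.1, rfl⟩
  refine ⟨⟨?_, ?_, fun i => hval (e i)⟩, ⟨?_, fun i => hdis (e i)⟩, ?_, ?_⟩
  · exact (e.symm none).pos
  · intro t ht
    by_cases htB : t ∈ B s.1
    · exact ⟨e.symm none, by simpa [prunedAnswers] using htB⟩
    · exact ⟨e.symm (some ⟨t, ht, htB⟩), by simp [prunedAnswers]⟩
  · have key : ∀ x y, x ≠ y →
        Disjoint (prunedAnswers R (B s.1) x) (prunedAnswers R (B s.1) y) := by
      rintro (_ | t) (_ | t') hxy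
      · exact absurd rfl hxy
      · exact Set.disjoint_singleton_right.2 t'.2.2
      · exact Set.disjoint_singleton_left.2 t.2.2
      · exact Set.disjoint_singleton.2 fun h => hxy (congrArg some (Subtype.ext h))
    exact fun i j hij => key _ _ (e.injective.ne hij)
  · intro s' hs'
    exact hsim (e s'.1) (s'.2 s'.1) (hs'.2 s'.1 hs'.1)
  -- Only the branch `none` is selected; on the singletons any credible plan will do.
  · have hpl : ∀ x, ∃ q, (c' x).Credible (R ∩ prunedAnswers R (B s.1) x) q ∧
        (x = none → ∀ f, (c' x).payoff f q w = (c s.1).payoff f (s.2 s.1) w) := by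
      rintro (_ | t)
      · obtain ⟨q, hq, hp⟩ := h.exists_plan
        exact ⟨q, hq, fun _ => hp⟩
      · obtain ⟨q, hq⟩ := (hval (some t)).exists_credible (hne (some t))
        exact ⟨q, hq, fun h => nomatch h⟩
    choose q hq hp using hpl
    exact ⟨(e.symm none, fun i => q (e i)), ⟨hne _, fun i _ => hq (e i)⟩,
      fun f => hp _ (e.apply_symm_apply none) f⟩

/-- The root is required to be a signal so that it can merge with a signal above it; the depth bound
does not count it. -/
theorem exists_prunes [Fintype Θ] [Fintype T] {u : T → Θ → A → ℝ} (N : MechTree Θ A T)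
    {R : Set T} {w : Θ → ℝ} (hv : N.Valid u R w) (s : N.Plan) (hs : N.Credible R s) :
    ∃ (m : ℕ) (π : Θ → Fin m → ℝ) (c : Fin m → MechTree Θ A T),
      N.Prunes u R w s (signal m π c) ∧ ∀ k, (c k).depth ≤ 2 * (R.ncard - 1) := by
  classical
  induction N generalizing R w with
  | leaf act =>
    refine ⟨1, _, _, Prunes.trivial_signal (N' := leaf act) ⟨hv, trivial,
      fun s' hs' => ⟨s', hs', fun _ => rfl⟩, s, hs, fun _ => rfl⟩, fun _ => Nat.zero_le _⟩
  | signal m π c ih =>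
    choose m' π' c' h hd using fun k => ih k (hv.2 k) (s k) (hs k)
    exact ⟨_, _, _, Prunes.signal hv.1 h (Fintype.equivFin _).symm, fun i => hd _ _⟩
  | menu m c ih =>
    obtain ⟨m', π', c', h, hd⟩ := ih s.1 (hv.2 s.1) (s.2 s.1) (hs s.1)
    exact ⟨m', π', c', ⟨h.valid, h.disjoint, h.simulates.menu hs, h.exists_plan⟩, hd⟩
  | elicit m B c ih =>
    obtain ⟨m', π', c', h, hd⟩ := ih s.1 (hv.2.2 s.1) (s.2 s.1) (hs.2 s.1 hs.1)
    -- A node that excludes nobody is skipped, so that each binding node kept lowers `R.ncard`.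
    by_cases hRB : R ⊆ B s.1
    · have hR : R ∩ B s.1 = R := Set.inter_eq_left.2 hRB
      have hsim := h.simulates.elicit hs hs.1
      obtain ⟨hval, hdis, -, hpl⟩ := h
      rw [hR] at hval hsim hpl hd
      exact ⟨m', π', c', ⟨hval, hdis, hsim, hpl⟩, hd⟩
    · have hsing : ∀ t : {t // t ∈ R \ B s.1}, ∃ D : MechTree Θ A T, D.depth ≤ 1 ∧
          ∃ k, t.1 ∈ B k ∧ ∃ r, (c k).Prunes u {t.1} w r D := by
        intro t
        obtain ⟨k, hk⟩ := hv.2.1 t.1 t.2.1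
        have hvk : (c k).Valid u {t.1} w :=
          (hv.2.2 k).mono (Set.singleton_subset_iff.2 ⟨t.2.1, hk⟩)
        obtain ⟨r, hr⟩ := hvk.exists_credible (Set.singleton_nonempty _)
        obtain ⟨n, π₁, c₁, h₁, hd₁⟩ := ih k hvk r hr
        refine ⟨_, ?_, k, hk, r, h₁⟩
        simp only [Set.ncard_singleton, Nat.sub_self, Nat.mul_zero] at hd₁
        simpa [depth] using hd₁
      choose D hD hDp using hsing
      let C : Option {t // t ∈ R \ B s.1} → MechTree Θ A T :=
        fun x => x.elim (MechTree.signal m' π' c') D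
      have hpos : 0 < (R ∩ B s.1).ncard := (Set.ncard_pos (Set.toFinite _)).2 hs.1
      have hlt : (R ∩ B s.1).ncard < R.ncard :=
        Set.ncard_lt_ncard (Set.inter_ssubset_left_iff.2 hRB) (Set.toFinite _)
      have hC : ∀ x, (C x).depth ≤ 1 + 2 * ((R ∩ B s.1).ncard - 1) := by
        rintro (_ | t)
        · exact Nat.add_le_add_left (Finset.sup_le fun k _ => hd k) 1
        · exact (hD t).trans (Nat.le_add_right _ _)
      refine ⟨1, _, _, (Prunes.elicit hv hs (c' := C) h hDp
        (Fintype.equivFin _).symm).trivial_signal, fun _ => ?_⟩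
      -- The binding node and the signal below it cost 2, which is paid for by `1 ≤ (R ∩ B
      -- s.1).ncard < R.ncard`.
      refine (Nat.add_le_add_left (Finset.sup_le fun i _ => hC _) 1).trans ?_
      omega

end MechTree

theorem mainTheorem5 :
    ∃ C : ℕ, ∀ {Θ A T : Type*} [Fintype Θ] [Fintype T] (I : PersuasionInstance Θ A T)
      (P : PIEMechanism I), ∃ P' : PIEMechanism I,
        P'.tree.depth ≤ C * Fintype.card T ∧
        P'.tree.DisjointAnswers ∧
        P.principalPayoff ≤ P'.principalPayoff := by
  -- Root menu, one signal, and `2 * (n - 1)` levels below: `2 * n` in total.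
  refine ⟨2, fun {Θ A T} _ _ I P => ?_⟩
  have hpos : 0 < Fintype.card T := by
    rw [Fintype.card_pos_iff]
    by_contra hT
    rw [not_nonempty_iff] at hT
    simpa using I.ρ_mem.2
  choose m π c h hd using fun t =>
    MechTree.exists_prunes P.tree P.valid (P.plan t) (P.credible t)
  choose q hq hp using fun t => (h t).exists_plan
  let e := (Fintype.equivFin T).symm
  let N := MechTree.menu (Fintype.card T)
    fun i => MechTree.signal (m (e i)) (π (e i)) (c (e i))
  let plan : T → N.Plan := fun t => (e.symm t, fun i => q (e i))
  have hplan : ∀ t f, N.payoff f (plan t) I.μ = P.tree.payoff f (P.plan t) I.μ := by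
    intro t f
    refine (hp (e (e.symm t)) f).trans ?_
    rw [e.apply_symm_apply]
  refine ⟨⟨N, ⟨hpos, fun i => (h (e i)).valid⟩, plan, fun t i => hq (e i), ?_⟩, ?_, ?_, ?_⟩
  · intro t s hs
    -- A deviation, even into the tree pruned for another type, has the outcome of a credible plan
    -- of `P`, which optimality of `P.plan t` already covers.
    obtain ⟨r, hr, hpr⟩ := (h (e s.1)).simulates (s.2 s.1) (hs s.1)
    rw [hplan]
    exact (hpr (I.u t)).symm.trans_le (P.optimal t r hr)
  · have hN : ∀ i, (MechTree.signal (m (e i)) (π (e i)) (c (e i))).depth ≤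
        1 + 2 * ((Set.univ : Set T).ncard - 1) := fun i =>
      Nat.add_le_add_left (Finset.sup_le fun k _ => hd (e i) k) 1
    refine (Nat.add_le_add_left (Finset.sup_le fun i _ => hN i) 1).trans ?_
    rw [Set.ncard_univ, Nat.card_eq_fintype_card]
    omega
  · exact fun i => (h (e i)).disjoint
  · exact le_of_eq (Finset.sum_congr rfl fun t _ => congrArg _ (hplan t I.v).symm)
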